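/- All graphs are finite, simple and undirected. The total graph $T(G)$ of a graph $G$ has vertex set $V(G)\cup E(G)$ (disjoint union); two vertices of $T(G)$ are adjacent if and only if they are adjacent vertices of $G$, or distinct edges of $G$ sharing an end, or a vertex and an edge of $G$ incident with each other. For a graph $G$ and a set $S\subseteq V(G)$ with $|S|\ge 2$, an $S$-Steiner tree is a subgraph of $G$ that is a tree and whose vertex set contains $S$, and $\lambda(S)$ is the maximum number of pairwise edge-disjoint $S$-Steiner trees in $G$. For $2\le k\le |V(G)|$, the generalized $k$-edge-connectivity of $G$ is $\lambda_k(G)=\min\{\lambda(S) : S\subseteq V(G),\ |S|=k\}$. **Theorem.** Let $1\le m\le n$ be integers and let $K_{m,n}$ be the complete bipartite graph with parts of sizes $m$ and $n$. Then $$\lambda_3(T(K_{m,n}))=\begin{cases}2m-1, & \text{if } m=n,\\ 2m, & \text{if } m<n.\end{cases}$$ -/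

import Mathlib

/-- The total graph `T(G)`: its vertices are the vertices and the edges of `G`. Two vertices of `G`
are adjacent in `T(G)` when they are adjacent in `G`, two edges of `G` when they are distinct and
share an end, and a vertex and an edge when they are incident. -/
def SimpleGraph.totalGraph {V : Type*} (G : SimpleGraph V) : SimpleGraph (V ⊕ G.edgeSet) where
  Adj
    | .inl u, .inl v => G.Adj u v
    | .inr e, .inr f => G.lineGraph.Adj e f
    | .inl u, .inr e => u ∈ (e : Sym2 V)
    | .inr e, .inl u => u ∈ (e : Sym2 V)
  symm := ⟨by
    rintro (u | e) (v | f) h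
    · exact G.adj_symm h
    · exact h
    · exact h
    · exact G.lineGraph.adj_symm h⟩
  loopless := ⟨by
    rintro (u | e) h
    · exact G.irrefl h
    · exact G.lineGraph.irrefl h⟩

/-- An `S`-Steiner tree of `G`: a subgraph of `G` that is a tree and whose vertex set contains
`S`. -/
def SimpleGraph.Subgraph.IsSteinerTree {V : Type*} {G : SimpleGraph V} (T : G.Subgraph)
    (S : Finset V) : Prop :=
  T.coe.IsTree ∧ (S : Set V) ⊆ T.verts

/-- The generalized local edge-connectivity `λ(S)`: the maximum number of pairwise edge-disjoint
`S`-Steiner trees in `G` (`⊤` if there is no bound, which cannot happen for `G` finite). -/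
noncomputable def SimpleGraph.localEdgeConn {V : Type*} (G : SimpleGraph V) (S : Finset V) : ℕ∞ :=
  ⨆ (F : Set G.Subgraph) (_ : ∀ T ∈ F, T.IsSteinerTree S)
    (_ : F.PairwiseDisjoint SimpleGraph.Subgraph.edgeSet), F.encard

/-- The generalized `k`-edge-connectivity `λ_k(G)`: the minimum of `λ(S)` over the `k`-element sets
`S` of vertices of `G`, for `2 ≤ k ≤ |V(G)|` (`⊤` if there is no such set). -/
noncomputable def SimpleGraph.genEdgeConn {V : Type*} (k : ℕ) (G : SimpleGraph V) : ℕ∞ :=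
  ⨅ (S : Finset V) (_ : S.card = k), G.localEdgeConn S

/-! Upper bound. Take a flag as terminals: a vertex `i` of the first part, a vertex `j` of the
second part, and the edge `ij`. The vertex `j` has degree `2m` in the total graph and every tree
uses an edge there, so there are at most `2m` trees. If `m = n`, then `i` and `j` both have degree
`2m` and are adjacent, so only `4m - 1` edges touch `{i, j}`. A tree needs two of them, since it
meets both `i` and `j` and also leaves `{i, j}`; hence at most `2m - 1` trees. See
`localEdgeConn_flag_le` and `localEdgeConn_flag_le_sub_one`, both by the count in
`mul_localEdgeConn_le`.

Lower bound. The vertices form an `m × n` grid with headers: each row with its head is a clique,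
each column with its head is a clique, and row heads are joined to column heads. If the terminals
avoid row `r` and column `c`, the edges touching that row or column contain two disjoint connecting
subgraphs on top of those in the smaller grid (`SteinerPacks.add_row_col`). Three terminals always
miss a row and a column once there are four of each, and `2m - 1` and `2m` both grow by two with
`m`, so induction applies (`Packs3.succ`); surplus columns can be ignored (`Packs3.succ_col`). The
small grids are settled by explicit packings, checked by computation up to permutations of rows and
columns. -/

namespace SimpleGraph

/-! ### Connecting subgraphs versus Steiner trees. -/

variable {V W : Type*}

/-- There are `t` pairwise edge-disjoint subgraphs of `G`, each of which connects the vertices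
in `S`. -/
def SteinerPacks (G : SimpleGraph V) (S : Set V) (t : ℕ) : Prop :=
  ∃ L : List (SimpleGraph V), L.length = t ∧ L.Pairwise Disjoint ∧
    ∀ H ∈ L, H ≤ G ∧ ∀ u ∈ S, ∀ v ∈ S, H.Reachable u v

theorem disjoint_of_adj {G H : SimpleGraph V} (h : ∀ u v, G.Adj u v → ¬ H.Adj u v) :
    Disjoint G H := by
  rw [disjoint_iff_inf_le]
  intro u v huv
  exact h u v huv.1 huv.2

theorem not_adj_of_disjoint {G H : SimpleGraph V} (h : Disjoint G H) {u v : V} (hG : G.Adj u v) :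
    ¬ H.Adj u v := fun hH => by
  have : (G ⊓ H).Adj u v := ⟨hG, hH⟩
  rw [h.eq_bot] at this
  exact this

theorem SteinerPacks.map {G : SimpleGraph V} {G' : SimpleGraph W} {S : Set V} {t : ℕ}
    (h : G.SteinerPacks S t) (f : V ↪ W) (hf : G.map f ≤ G') : G'.SteinerPacks (f '' S) t := by
  obtain ⟨L, hL, hd, hH⟩ := h
  refine ⟨L.map (fun H => H.map f), by simpa, ?_, ?_⟩
  · rw [List.pairwise_map]
    refine hd.imp fun {A B} hAB => disjoint_of_adj ?_
    rintro u v ⟨hne, a, b, hab, rfl, rfl⟩ ⟨-, a', b', hab', ha, hb⟩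
    obtain rfl := f.injective ha
    obtain rfl := f.injective hb
    exact not_adj_of_disjoint hAB hab hab'
  · simp only [List.mem_map, forall_exists_index, and_imp]
    rintro _ H hHL rfl
    refine ⟨(SimpleGraph.map_monotone f (hH H hHL).1).trans hf, ?_⟩
    rintro _ ⟨u, hu, rfl⟩ _ ⟨v, hv, rfl⟩
    exact ((hH H hHL).2 u hu v hv).map (SimpleGraph.Embedding.map f H).toHom

/-- A graph that connects `S` contains an `S`-Steiner tree. -/
theorem exists_isSteinerTree {G H : SimpleGraph V} (hHG : H ≤ G) {S : Finset V}
    (hS : S.Nonempty) (h : ∀ u ∈ S, ∀ v ∈ S, H.Reachable u v) :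
    ∃ T : G.Subgraph, T.IsSteinerTree S ∧ T.edgeSet ⊆ H.edgeSet := by
  obtain ⟨v₀, hv₀⟩ := hS
  -- A spanning tree of the whole component of `v₀` serves: a Steiner tree may have vertices outside
  -- `S`.
  obtain ⟨T, hT, hTt⟩ :=
    (H.connectedComponentMk v₀).connected_toSimpleGraph.exists_isTree_le
  let K := H.connectedComponentMk v₀
  let T' : G.Subgraph :=
    { verts := K.supp
      Adj := fun u v => ∃ (hu : u ∈ K.supp) (hv : v ∈ K.supp), T.Adj ⟨u, hu⟩ ⟨v, hv⟩
      adj_sub := fun ⟨_, _, h⟩ => hHG (hT h)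
      edge_vert := fun ⟨hu, _⟩ => hu
      symm := ⟨fun _ _ ⟨hu, hv, h⟩ => ⟨hv, hu, h.symm⟩⟩ }
  have hcoe : T'.coe = T := by
    ext u v
    exact ⟨fun ⟨_, _, h⟩ => h, fun h => ⟨u.2, v.2, h⟩⟩
  refine ⟨T', ⟨hcoe ▸ hTt, fun v hv => ?_⟩, ?_⟩
  · exact ConnectedComponent.sound (h v hv v₀ hv₀)
  · intro e
    induction e with
    | h u v =>
      rintro ⟨_, _, h⟩
      exact hT h

/-- A walk in the tree from `u` to `v` crosses the boundary of `A`. The upper bounds use no other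
property of Steiner trees. -/
theorem Subgraph.IsSteinerTree.exists_adj {G : SimpleGraph V} {T : G.Subgraph} {S : Finset V}
    (hT : T.IsSteinerTree S) {A : Set V} {u v : V} (hu : u ∈ S) (huA : u ∈ A) (hv : v ∈ S)
    (hvA : v ∉ A) : ∃ a ∈ A, ∃ b ∉ A, T.Adj a b := by
  obtain ⟨p⟩ := hT.1.connected.preconnected ⟨u, hT.2 hu⟩ ⟨v, hT.2 hv⟩
  obtain ⟨d, -, h1, h2⟩ := p.exists_boundary_dart (Subtype.val ⁻¹' A) huA hvA
  exact ⟨_, h1, _, h2, d.adj⟩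

/-- With two terminals every tree has an edge, so edge-disjoint trees are distinct and passing from
a list to a set loses none. -/
theorem SteinerPacks.le_localEdgeConn {G : SimpleGraph V} {S : Finset V} {t : ℕ}
    (h : G.SteinerPacks S t) (hS : 2 ≤ S.card) : (t : ℕ∞) ≤ G.localEdgeConn S := by
  classical
  obtain ⟨L, rfl, hd, hH⟩ := h
  have hS0 : S.Nonempty := Finset.card_pos.mp (by omega)
  obtain ⟨u, hu, v, hv, huv⟩ := Finset.one_lt_card.mp hS
  have key : ∀ H : {H // H ∈ L}, ∃ T : G.Subgraph, T.IsSteinerTree S ∧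
      T.edgeSet ⊆ H.1.edgeSet := fun H => exists_isSteinerTree (hH H H.2).1 hS0 (hH H H.2).2
  choose T hT hTe using key
  have hdis : (L.attach.map T).Pairwise fun A B => Disjoint A.edgeSet B.edgeSet := by
    rw [List.pairwise_map]
    have : L.attach.Pairwise fun A B => Disjoint A.1 B.1 := by
      rw [← List.pairwise_map, List.attach_map_subtype_val]
      exact hd
    exact this.imp fun {A B} hAB =>
      (disjoint_edgeSet.mpr hAB).mono (hTe A) (hTe B)
  have hne : ∀ A ∈ L.attach.map T, A.edgeSet.Nonempty := by
    intro A hA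
    obtain ⟨H, -, rfl⟩ := List.mem_map.mp hA
    obtain ⟨a, -, b, -, hab⟩ := (hT H).exists_adj (A := {u}) hu rfl hv huv.symm
    exact ⟨s(a, b), hab⟩
  have hnd : (L.attach.map T).Nodup := by
    refine List.Pairwise.imp_of_mem (fun {A B} hA hB hAB => ?_) hdis
    rintro rfl
    exact (hne A hA).ne_empty (disjoint_self.mp hAB)
  have hcard : (((L.attach.map T).toFinset : Set G.Subgraph)).encard = L.length := by
    rw [Set.encard_coe_eq_coe_finsetCard, List.toFinset_card_of_nodup hnd]
    simp
  rw [← hcard]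
  refine le_iSup_of_le _ (le_iSup_of_le ?_ (le_iSup_of_le ?_ le_rfl))
  · intro A hA
    obtain ⟨H, -, rfl⟩ := List.mem_map.mp (List.mem_toFinset.mp hA)
    exact hT H
  · intro A hA B hB hAB
    have : Std.Symm fun A B : G.Subgraph => Disjoint A.edgeSet B.edgeSet := ⟨fun _ _ h => h.symm⟩
    exact hdis.forall (List.mem_toFinset.mp hA) (List.mem_toFinset.mp hB) hAB

/-- If every `S`-Steiner tree has at least `k` edges in the finite set `I`, then `k * λ(S)` is at
most the cardinality of `I`. -/
theorem mul_localEdgeConn_le {G : SimpleGraph V} {S : Finset V} (I : Finset (Sym2 V)) {k b : ℕ}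
    (hI : ∀ T : G.Subgraph, T.IsSteinerTree S → ∃ J ⊆ I, J.card = k ∧ (J : Set (Sym2 V)) ⊆ T.edgeSet)
    (hb : I.card < k * (b + 1)) : G.localEdgeConn S ≤ b := by
  classical
  refine iSup_le fun F => iSup_le fun hF => iSup_le fun hd => ?_
  by_contra! hlt
  have hle : ((b + 1 : ℕ) : ℕ∞) ≤ F.encard := by
    push_cast
    exact Order.add_one_le_of_lt hlt
  -- The family might be infinite, so the count is made on exactly `b + 1` of its trees.
  obtain ⟨F', hF', hcard⟩ := Set.exists_subset_encard_eq hle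
  have hfin : F'.Finite := Set.finite_of_encard_eq_coe hcard
  lift F' to Finset G.Subgraph using hfin
  rw [Set.encard_coe_eq_coe_finsetCard, Nat.cast_inj] at hcard
  choose! J hJI hJk hJT using hI
  have h1 : (F'.biUnion J).card = ∑ T ∈ F', (J T).card := by
    refine Finset.card_biUnion fun A hA B hB hAB => ?_
    refine Finset.disjoint_coe.mp ?_
    exact (hd (hF' hA) (hF' hB) hAB).mono (hJT A (hF A (hF' hA))) (hJT B (hF B (hF' hB)))
  rw [Finset.sum_congr rfl fun T hT => hJk T (hF T (hF' hT)), Finset.sum_const, hcard] at h1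
  have h2 := Finset.card_le_card (Finset.biUnion_subset.mpr fun T hT => hJI T (hF T (hF' hT)))
  rw [h1, smul_eq_mul, mul_comm] at h2
  omega

end SimpleGraph

namespace SimpleGraph

/-! ### The grid model of the total graph. -/

variable {R C R' C' : Type*}

/-- A vertex of the total graph of the complete bipartite graph with parts `R` and `C`, seen as a
cell of a grid with rows `R` and columns `C` that has an additional header column (`inl (inl i)`)
and an additional header row (`inl (inr j)`). -/
abbrev Cell (R C : Type*) := (R ⊕ C) ⊕ (R × C)

/-- Adjacency in the total graph of a complete bipartite graph, in terms of cells. -/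
def cellAdj : Cell R C → Cell R C → Prop
  | .inl (.inl _), .inl (.inl _) => False
  | .inl (.inl _), .inl (.inr _) => True
  | .inl (.inr _), .inl (.inl _) => True
  | .inl (.inr _), .inl (.inr _) => False
  | .inl (.inl i), .inr (k, _) => i = k
  | .inl (.inr j), .inr (_, l) => j = l
  | .inr (k, _), .inl (.inl i) => i = k
  | .inr (_, l), .inl (.inr j) => j = l
  | .inr (i, j), .inr (k, l) => i = k ∧ j ≠ l ∨ i ≠ k ∧ j = l

instance [DecidableEq R] [DecidableEq C] : DecidableRel (cellAdj : Cell R C → Cell R C → Prop)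
  | .inl (.inl _), .inl (.inl _) => inferInstanceAs (Decidable False)
  | .inl (.inl _), .inl (.inr _) => inferInstanceAs (Decidable True)
  | .inl (.inr _), .inl (.inl _) => inferInstanceAs (Decidable True)
  | .inl (.inr _), .inl (.inr _) => inferInstanceAs (Decidable False)
  | .inl (.inl i), .inr (k, _) => inferInstanceAs (Decidable (i = k))
  | .inl (.inr j), .inr (_, l) => inferInstanceAs (Decidable (j = l))
  | .inr (k, _), .inl (.inl i) => inferInstanceAs (Decidable (i = k))
  | .inr (_, l), .inl (.inr j) => inferInstanceAs (Decidable (j = l))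
  | .inr (i, j), .inr (k, l) => inferInstanceAs (Decidable (i = k ∧ j ≠ l ∨ i ≠ k ∧ j = l))

/-- The total graph of the complete bipartite graph with parts `R` and `C`, on cells. -/
def cellGraph (R C : Type*) : SimpleGraph (Cell R C) where
  Adj := cellAdj
  symm := ⟨by
    rintro ((i | j) | ⟨i, j⟩) ((k | l) | ⟨k, l⟩) h <;> simp_all [cellAdj, eq_comm]⟩
  loopless := ⟨by rintro ((i | j) | ⟨i, j⟩) <;> simp [cellAdj]⟩

/-- The map on cells induced by injections of rows and columns. -/
def cellMap (f : R ↪ R') (g : C ↪ C') : Cell R C ↪ Cell R' C' :=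
  (f.sumMap g).sumMap (f.prodMap g)

theorem cellGraph_map_le (f : R ↪ R') (g : C ↪ C') :
    (cellGraph R C).map (cellMap f g) ≤ cellGraph R' C' := by
  rintro _ _ ⟨-, u, v, h, rfl, rfl⟩
  obtain ((i | j) | ⟨i, j⟩) := u <;> obtain ((k | l) | ⟨k, l⟩) := v <;>
    simp_all [cellGraph, cellAdj, cellMap]

/-- Interchanging rows and columns. -/
def cellSwap : Cell R C ↪ Cell C R :=
  ((Equiv.sumComm R C).sumCongr (Equiv.prodComm R C)).toEmbedding

theorem cellGraph_map_cellSwap_le : (cellGraph R C).map cellSwap ≤ cellGraph C R := by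
  rintro _ _ ⟨-, u, v, h, rfl, rfl⟩
  obtain ((i | j) | ⟨i, j⟩) := u <;> obtain ((k | l) | ⟨k, l⟩) := v <;>
    simp_all [cellGraph, cellAdj, cellSwap]
  tauto

/-! ### Two additional trees from a free row and a free column. -/

section Augment

variable (r : R) (c : C)

/-- The edges that join every cell outside row `r` and column `c` to the head of column `c`, mainly
through the cells of column `c`. -/
def colRel : Cell R C → Cell R C → Prop
  | .inl (.inl i), .inr (k, l) => i = k ∧ i ≠ r ∧ l = c
  | .inl (.inr _), .inl (.inl i) => i = r
  | .inr (i, j), .inr (k, l) => i = k ∧ i ≠ r ∧ j ≠ c ∧ l = c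
  | .inr (i, j), .inl (.inr l) => i ≠ r ∧ j = c ∧ l = c
  | _, _ => False

/-- The edges that join every cell outside row `r` and column `c` to the head of column `c`, mainly
through the cells of row `r`. -/
def rowRel : Cell R C → Cell R C → Prop
  | .inl (.inl i), .inl (.inr l) => i ≠ r ∧ l = c
  | .inl (.inr j), .inr (k, l) => k = r ∧ j = l
  | .inr (i, j), .inr (k, l) => k = r ∧ (i ≠ r ∧ j = l ∧ j ≠ c ∨ i = r ∧ j ≠ c ∧ l = c)
  | _, _ => False

theorem fromRel_colRel_le : fromRel (colRel r c) ≤ cellGraph R C := by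
  rintro ((i | j) | ⟨i, j⟩) ((k | l) | ⟨k, l⟩) h <;>
    simp only [fromRel_adj, colRel, cellGraph, cellAdj] at h ⊢ <;> grind

theorem fromRel_rowRel_le : fromRel (rowRel r c) ≤ cellGraph R C := by
  rintro ((i | j) | ⟨i, j⟩) ((k | l) | ⟨k, l⟩) h <;>
    simp only [fromRel_adj, rowRel, cellGraph, cellAdj] at h ⊢ <;> grind

theorem disjoint_colRel_rowRel : Disjoint (fromRel (colRel r c)) (fromRel (rowRel r c)) := by
  refine disjoint_of_adj ?_
  rintro ((i | j) | ⟨i, j⟩) ((k | l) | ⟨k, l⟩) h h' <;>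
    simp only [fromRel_adj, colRel, rowRel] at h h' <;> grind

variable {r c} {f : R' ↪ R} {g : C' ↪ C}

/-- Every edge of `colRel` has an end in row `r` or column `c`, heads included, while the embedded
smaller grid avoids both. -/
theorem disjoint_colRel_map (hr : r ∉ Set.range f) (hc : c ∉ Set.range g)
    (H : SimpleGraph (Cell R' C')) : Disjoint (fromRel (colRel r c)) (H.map (cellMap f g)) := by
  refine disjoint_of_adj ?_
  rintro _ _ h ⟨-, u, v, -, rfl, rfl⟩
  simp only [Set.mem_range, not_exists] at hr hc
  obtain ((i | j) | ⟨i, j⟩) := u <;> obtain ((k | l) | ⟨k, l⟩) := v <;>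
    simp_all [colRel, cellMap]

theorem disjoint_rowRel_map (hr : r ∉ Set.range f) (hc : c ∉ Set.range g)
    (H : SimpleGraph (Cell R' C')) : Disjoint (fromRel (rowRel r c)) (H.map (cellMap f g)) := by
  refine disjoint_of_adj ?_
  rintro _ _ h ⟨-, u, v, -, rfl, rfl⟩
  simp only [Set.mem_range, not_exists] at hr hc
  obtain ((i | j) | ⟨i, j⟩) := u <;> obtain ((k | l) | ⟨k, l⟩) := v <;>
    simp_all [rowRel, cellMap]

/-- Row heads and inner cells step along their row into column `c` and then to its head; column
heads go through the head of row `r`. -/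
theorem reachable_colRel (hr : r ∉ Set.range f) (hc : c ∉ Set.range g) (u : Cell R' C') :
    (fromRel (colRel r c)).Reachable (cellMap f g u) (.inl (.inr c)) := by
  simp only [Set.mem_range, not_exists] at hr hc
  have key : ∀ i ≠ r, (fromRel (colRel r c)).Reachable (.inr (i, c)) (.inl (.inr c)) := fun i hi =>
    Adj.reachable (by simp [colRel, hi])
  obtain ((i | j) | ⟨i, j⟩) := u
  · refine .trans (Adj.reachable ?_) (key (f i) (hr i))
    simp [colRel, cellMap, hr i]
  · refine .trans (v := .inl (.inl r)) (Adj.reachable ?_) (Adj.reachable ?_) <;>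
      simp [colRel, cellMap]
  · refine .trans (Adj.reachable ?_) (key (f i) (hr i))
    simp [colRel, cellMap, hr i, hc j]

/-- Here row heads reach the head of column `c` directly; column heads and inner cells step along
their column into row `r`, then go through the corner `(r, c)`. -/
theorem reachable_rowRel (hr : r ∉ Set.range f) (hc : c ∉ Set.range g) (u : Cell R' C') :
    (fromRel (rowRel r c)).Reachable (cellMap f g u) (.inl (.inr c)) := by
  simp only [Set.mem_range, not_exists] at hr hc
  have key : ∀ j ≠ c, (fromRel (rowRel r c)).Reachable (.inr (r, j)) (.inl (.inr c)) :=
    fun j hj => .trans (v := .inr (r, c)) (Adj.reachable (by simp [rowRel, hj]))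
      (Adj.reachable (by simp [rowRel]))
  obtain ((i | j) | ⟨i, j⟩) := u
  · refine Adj.reachable ?_
    simp [rowRel, cellMap, hr i]
  · refine .trans (Adj.reachable ?_) (key (g j) (hc j))
    simp [rowRel, cellMap]
  · refine .trans (Adj.reachable ?_) (key (g j) (hc j))
    simp [rowRel, cellMap, hr i, hc j]

/-- A new row together with a new column allows for two more trees. -/
theorem SteinerPacks.add_row_col {S : Set (Cell R' C')} {t : ℕ}
    (h : (cellGraph R' C').SteinerPacks S t) (hr : r ∉ Set.range f) (hc : c ∉ Set.range g) :
    (cellGraph R C).SteinerPacks (cellMap f g '' S) (t + 2) := by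
  obtain ⟨L, hL, hd, hH⟩ := h.map (cellMap f g) le_rfl
  have hdis : ∀ H ∈ L, Disjoint (fromRel (colRel r c)) H ∧ Disjoint (fromRel (rowRel r c)) H := by
    intro H hHL
    have hle := (hH H hHL).1
    exact ⟨(disjoint_colRel_map hr hc _).mono_right hle,
      (disjoint_rowRel_map hr hc _).mono_right hle⟩
  refine ⟨fromRel (colRel r c) :: fromRel (rowRel r c) :: L, by simp [hL], ?_, ?_⟩
  · simp only [List.pairwise_cons, List.mem_cons]
    refine ⟨?_, fun H hHL => (hdis H hHL).2, hd⟩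
    rintro H (rfl | hHL)
    · exact disjoint_colRel_rowRel r c
    · exact (hdis H hHL).1
  · simp only [List.mem_cons]
    rintro H (rfl | rfl | hHL)
    · refine ⟨fromRel_colRel_le r c, ?_⟩
      rintro _ ⟨u, -, rfl⟩ _ ⟨v, -, rfl⟩
      exact (reachable_colRel hr hc u).trans (reachable_colRel hr hc v).symm
    · refine ⟨fromRel_rowRel_le r c, ?_⟩
      rintro _ ⟨u, -, rfl⟩ _ ⟨v, -, rfl⟩
      exact (reachable_rowRel hr hc u).trans (reachable_rowRel hr hc v).symm
    · exact ⟨(hH H hHL).1.trans (cellGraph_map_le f g), (hH H hHL).2⟩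

end Augment

/-! ### Identification of the grid with the total graph. -/

section TotalGraph

/-- The edge of a complete bipartite graph with given ends. -/
def bipartiteEdge (i : R) (j : C) : (completeBipartiteGraph R C).edgeSet :=
  ⟨s(.inl i, .inr j), by simp⟩

theorem exists_eq_bipartiteEdge (e : (completeBipartiteGraph R C).edgeSet) :
    ∃ i j, e = bipartiteEdge i j := by
  obtain ⟨e, he⟩ := e
  induction e with
  | h u v =>
    obtain (i | j) := u <;> obtain (k | l) := v
    · simp at he
    · exact ⟨i, l, rfl⟩
    · exact ⟨k, j, Subtype.ext Sym2.eq_swap⟩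
    · simp at he

theorem mem_bipartiteEdge {i : R} {j : C} {v : R ⊕ C} :
    v ∈ (bipartiteEdge i j : Sym2 (R ⊕ C)) ↔ v = .inl i ∨ v = .inr j := by
  simp [bipartiteEdge]

theorem bipartiteEdge_inj {i k : R} {j l : C} :
    bipartiteEdge i j = bipartiteEdge k l ↔ i = k ∧ j = l := by
  simp [bipartiteEdge, Subtype.ext_iff]

/-- The vertex of the total graph that corresponds to a cell. -/
def totalCell : Cell R C ↪ (R ⊕ C) ⊕ (completeBipartiteGraph R C).edgeSet where
  toFun := Sum.map id fun p => bipartiteEdge p.1 p.2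
  inj' := by
    refine Sum.map_injective.mpr ⟨Function.injective_id, fun p q h => ?_⟩
    exact Prod.ext_iff.mpr (bipartiteEdge_inj.mp h)

theorem totalCell_surjective : Function.Surjective (totalCell (R := R) (C := C)) := by
  rintro (v | e)
  · exact ⟨.inl v, rfl⟩
  · obtain ⟨i, j, rfl⟩ := exists_eq_bipartiteEdge e
    exact ⟨.inr (i, j), rfl⟩

theorem totalGraph_adj_totalCell {u v : Cell R C} :
    (completeBipartiteGraph R C).totalGraph.Adj (totalCell u) (totalCell v) ↔
      (cellGraph R C).Adj u v := by
  obtain ((i | j) | ⟨i, j⟩) := u <;> obtain ((k | l) | ⟨k, l⟩) := v <;>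
    simp [totalGraph, totalCell, cellGraph, cellAdj, mem_bipartiteEdge, lineGraph,
      bipartiteEdge_inj, Set.Nonempty]
  all_goals grind

theorem map_totalCell_le :
    (cellGraph R C).map totalCell ≤ (completeBipartiteGraph R C).totalGraph := by
  rintro _ _ ⟨-, u, v, h, rfl, rfl⟩
  exact totalGraph_adj_totalCell.mpr h

end TotalGraph

end SimpleGraph

namespace SimpleGraph

/-! ### Subgraphs described by two walks. -/

section Walks

variable {V : Type*}

/-- The pairs of consecutive entries of a list. -/
def steps (l : List V) : List (V × V) := l.zip l.tail

theorem reachable_of_steps {H : SimpleGraph V} :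
    ∀ (a : V) (l : List V), (∀ p ∈ steps (a :: l), H.Reachable p.1 p.2) →
      ∀ v ∈ a :: l, H.Reachable a v
  | a, [], _, v, hv => by
    obtain rfl : v = a := by simpa using hv
    exact .rfl
  | a, b :: l, h, v, hv => by
    have hab : H.Reachable a b := h (a, b) (by simp [steps])
    rcases List.mem_cons.mp hv with rfl | hv
    · exact .rfl
    · refine hab.trans (reachable_of_steps b l (fun p hp => h p ?_) v hv)
      simp only [steps, List.tail_cons, List.zip_cons_cons, List.mem_cons] at hp ⊢
      exact .inr hp

theorem reachable_of_mem {H : SimpleGraph V} {l : List V}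
    (h : ∀ p ∈ steps l, H.Reachable p.1 p.2) {u v : V} (hu : u ∈ l) (hv : v ∈ l) :
    H.Reachable u v := by
  cases l with
  | nil => simp at hu
  | cons a l => exact (reachable_of_steps a l h u hu).symm.trans (reachable_of_steps a l h v hv)

/-- The edges of two walks. -/
def pairSteps (T : List V × List V) : List (V × V) := steps T.1 ++ steps T.2

/-- The graph formed by the edges of two walks. -/
def pairGraph (T : List V × List V) : SimpleGraph V := fromRel fun u v => (u, v) ∈ pairSteps T

/-- Two walks with a common vertex suffice for three terminals: a minimal tree is a path between two
of them plus a branch to the third. -/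
theorem pairGraph_reachable {T : List V × List V} {w : V} (h₁ : w ∈ T.1) (h₂ : w ∈ T.2) {u v : V}
    (hu : u ∈ T.1 ∨ u ∈ T.2) (hv : v ∈ T.1 ∨ v ∈ T.2) : (pairGraph T).Reachable u v := by
  have hs : ∀ p ∈ pairSteps T, (pairGraph T).Reachable p.1 p.2 := by
    intro p hp
    by_cases h : p.1 = p.2
    · rw [h]
    · exact Adj.reachable ⟨h, .inl hp⟩
  have key : ∀ u, u ∈ T.1 ∨ u ∈ T.2 → (pairGraph T).Reachable u w := by
    rintro u (hu | hu)
    · exact reachable_of_mem (fun p hp => hs p (List.mem_append_left _ hp)) hu h₁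
    · exact reachable_of_mem (fun p hp => hs p (List.mem_append_right _ hp)) hu h₂
  exact (key u hu).trans (key v hv).symm

end Walks

/-! ### Explicit packings for small grids and their verification. -/

section Certificates

variable {m n : ℕ}

instance (v : Cell (Fin m) (Fin n)) (l : List (Cell (Fin m) (Fin n))) : Decidable (v ∈ l) :=
  @List.instDecidableMemOfLawfulBEq _ instBEqOfDecidableEq inferInstance v l

/-- Two-digit codes of cells: the digits are the row and the column, counted from `1`, and `0`
stands for a header. -/
def cellCode : Cell (Fin m) (Fin n) → ℕ
  | .inl (.inl i) => 10 * (i.val + 1)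
  | .inl (.inr j) => j.val + 1
  | .inr (i, j) => 10 * (i.val + 1) + (j.val + 1)

/-- The bound on `n` keeps the column a single digit. -/
theorem cellCode_injective (hn : n ≤ 9) :
    Function.Injective (cellCode : Cell (Fin m) (Fin n) → ℕ) := by
  rintro ((i | j) | ⟨i, j⟩) ((k | l) | ⟨k, l⟩) h <;> simp only [cellCode] at h <;>
    simp [Fin.ext_iff] <;> omega

/-- The cell with a given code. -/
def decodeCell (m n : ℕ) [NeZero m] [NeZero n] (k : ℕ) : Cell (Fin m) (Fin n) :=
  -- Out-of-range codes wrap around; this is harmless, since `isValid` tests the decoded cells.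
  if k % 10 = 0 then .inl (.inl (Fin.ofNat m (k / 10 - 1)))
  else if k / 10 = 0 then .inl (.inr (Fin.ofNat n (k % 10 - 1)))
  else .inr (Fin.ofNat m (k / 10 - 1), Fin.ofNat n (k % 10 - 1))

/-- A number that identifies an edge. -/
def edgeCode (p : Cell (Fin m) (Fin n) × Cell (Fin m) (Fin n)) : ℕ :=
  100 * max (cellCode p.1) (cellCode p.2) + min (cellCode p.1) (cellCode p.2)

/-- Symmetry is all that is needed of the code: different codes force different edges, so no
injectivity is required. -/
theorem edgeCode_swap (u v : Cell (Fin m) (Fin n)) : edgeCode (u, v) = edgeCode (v, u) := by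
  simp [edgeCode, max_comm, min_comm]

/-- Whether `L`, a list of pairs of walks, describes edge-disjoint connected subgraphs that contain
the cells in `S`. -/
def isPacking (S : List (Cell (Fin m) (Fin n)))
    (L : List (List (Cell (Fin m) (Fin n)) × List (Cell (Fin m) (Fin n)))) : Prop :=
  (L.map fun T => (pairSteps T).map edgeCode).flatten.Nodup ∧
    ∀ T ∈ L, (∀ p ∈ pairSteps T, cellAdj p.1 p.2) ∧ (∃ w ∈ T.2, w ∈ T.1) ∧
      ∀ v ∈ S, v ∈ T.1 ∨ v ∈ T.2

instance (S : List (Cell (Fin m) (Fin n)))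
    (L : List (List (Cell (Fin m) (Fin n)) × List (Cell (Fin m) (Fin n)))) :
    Decidable (isPacking S L) :=
  inferInstanceAs (Decidable (_ ∧ _))

theorem isPacking.steinerPacks {S : List (Cell (Fin m) (Fin n))}
    {L : List (List (Cell (Fin m) (Fin n)) × List (Cell (Fin m) (Fin n)))} (h : isPacking S L) :
    (cellGraph (Fin m) (Fin n)).SteinerPacks {v | v ∈ S} L.length := by
  obtain ⟨hnd, hL⟩ := h
  refine ⟨L.map pairGraph, by simp, ?_, ?_⟩
  · rw [List.pairwise_map]
    have := (List.nodup_flatten.mp hnd).2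
    rw [List.pairwise_map] at this
    refine this.imp fun {A B} hAB => disjoint_of_adj ?_
    have key : ∀ (T : List (Cell (Fin m) (Fin n)) × List (Cell (Fin m) (Fin n))) (u v),
        (pairGraph T).Adj u v → edgeCode (u, v) ∈ (pairSteps T).map edgeCode := by
      rintro T u v ⟨-, h | h⟩
      · exact List.mem_map_of_mem h
      · rw [edgeCode_swap]
        exact List.mem_map_of_mem h
    exact fun u v hu hv => hAB (key A u v hu) (key B u v hv)
  · simp only [List.mem_map]
    rintro _ ⟨T, hT, rfl⟩
    obtain ⟨hadj, ⟨w, hw2, hw1⟩, hS⟩ := hL T hT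
    refine ⟨?_, fun u hu v hv => pairGraph_reachable hw1 hw2 (hS u hu) (hS v hv)⟩
    rintro u v ⟨-, h | h⟩
    · exact hadj _ h
    · exact (cellGraph _ _).symm.symm _ _ (hadj _ h)

/-- The set of cells in a list, as a number. -/
def cellMask (S : List (Cell (Fin m) (Fin n))) : ℕ := (S.map fun v => 2 ^ cellCode v).sum

/-- Uniqueness of binary expansions. -/
theorem eq_toFinset_of_cellMask_eq (hn : n ≤ 9) {S T : List (Cell (Fin m) (Fin n))}
    (hS : S.Nodup) (hT : T.Nodup) (h : cellMask S = cellMask T) : S.toFinset = T.toFinset := by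
  have key : ∀ U : List (Cell (Fin m) (Fin n)), U.Nodup →
      cellMask U = ∑ k ∈ U.toFinset.image cellCode, 2 ^ k := by
    intro U hU
    rw [Finset.sum_image fun a _ b _ hab => cellCode_injective hn hab, List.sum_toFinset _ hU,
      cellMask]
  rw [key S hS, key T hT] at h
  exact Finset.image_injective (cellCode_injective hn) (Finset.geomSum_injective le_rfl h)

/-- The packings listed in a table, with terminals and walks given by codes, are packings of `t`
trees for lists of distinct terminals. -/
def isValid (m n t : ℕ) [NeZero m] [NeZero n]
    (table : List (List ℕ × List (List ℕ × List ℕ))) : Prop :=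
  ∀ E ∈ table, E.2.length = t ∧ (E.1.map (decodeCell m n)).Nodup ∧
    isPacking (E.1.map (decodeCell m n))
      (E.2.map fun T => (T.1.map (decodeCell m n), T.2.map (decodeCell m n)))

instance (m n t : ℕ) [NeZero m] [NeZero n] (table : List (List ℕ × List (List ℕ × List ℕ))) :
    Decidable (isValid m n t table) :=
  inferInstanceAs (Decidable (∀ E ∈ table, _))

/-- The masks of the images of the lists of terminals in a table under permutations of the rows and
of the columns. -/
def imageMasks (m n : ℕ) [NeZero m] [NeZero n]
    (table : List (List ℕ × List (List ℕ × List ℕ))) : List ℕ :=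
  table.flatMap fun E => (permsOfList (List.finRange m)).flatMap fun σ =>
    (permsOfList (List.finRange n)).map fun τ =>
      cellMask ((E.1.map (decodeCell m n)).map (cellMap σ.toEmbedding τ.toEmbedding))

/-- Permutations of rows and of columns are automorphisms of the grid graph, so one table entry
settles a whole orbit of terminal sets. -/
theorem isValid.steinerPacks {t : ℕ} [NeZero m] [NeZero n] (hn : n ≤ 9)
    {table : List (List ℕ × List (List ℕ × List ℕ))} (h : isValid m n t table)
    {S : List (Cell (Fin m) (Fin n))} (hS : S.Nodup) (hm : cellMask S ∈ imageMasks m n table) :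
    (cellGraph (Fin m) (Fin n)).SteinerPacks {v | v ∈ S} t := by
  simp only [imageMasks, List.mem_flatMap, List.mem_map] at hm
  obtain ⟨E, hE, σ, -, τ, -, hmask⟩ := hm
  obtain ⟨hlen, hnd, hpack⟩ := h E hE
  have h1 := hpack.steinerPacks.map (cellMap σ.toEmbedding τ.toEmbedding) (cellGraph_map_le _ _)
  rw [List.length_map, hlen] at h1
  have h2 := eq_toFinset_of_cellMask_eq hn (hnd.map (Function.Embedding.injective _)) hS hmask
  convert h1
  ext v
  rw [Set.mem_ofPred_eq, ← List.mem_toFinset, ← h2]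
  simp

/-- All cells. -/
def cells (m n : ℕ) : List (Cell (Fin m) (Fin n)) :=
  (List.finRange m).map (fun i => .inl (.inl i)) ++ (List.finRange n).map (fun j => .inl (.inr j)) ++
    (List.finRange m).flatMap fun i => (List.finRange n).map fun j => .inr (i, j)

theorem mem_cells (v : Cell (Fin m) (Fin n)) : v ∈ cells m n := by
  obtain ((i | j) | ⟨i, j⟩) := v <;> simp [cells]

/-- All cells of row `i`. -/
def rowCells (m n : ℕ) (i : Fin m) : List (Cell (Fin m) (Fin n)) :=
  .inl (.inl i) :: (List.finRange n).map fun j => .inr (i, j)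

/-- Whether every list of three cells with increasing codes, taken from the three given lists, is
covered by the masks in a list. -/
def covers (masks : List ℕ) (A B D : List (Cell (Fin m) (Fin n))) : Bool :=
  A.all fun u => B.all fun v => D.all fun w =>
    Nat.ble (cellCode v) (cellCode u) || Nat.ble (cellCode w) (cellCode v) ||
      masks.any fun k => Nat.beq k (cellMask [u, v, w])

theorem isValid.steinerPacks_of_covers {t : ℕ} [NeZero m] [NeZero n] (hn : n ≤ 9)
    {table : List (List ℕ × List (List ℕ × List ℕ))} (h : isValid m n t table)
    {A B D : List (Cell (Fin m) (Fin n))} (hc : covers (imageMasks m n table) A B D = true)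
    {u v w : Cell (Fin m) (Fin n)} (hu : u ∈ A) (hv : v ∈ B) (hw : w ∈ D)
    (huv : cellCode u < cellCode v) (hvw : cellCode v < cellCode w) :
    (cellGraph (Fin m) (Fin n)).SteinerPacks {u, v, w} t := by
  simp only [covers, List.all_eq_true, Bool.or_eq_true, List.any_eq_true, Nat.ble_eq,
    Nat.beq_eq] at hc
  have hmem : cellMask [u, v, w] ∈ imageMasks m n table := by
    rcases hc u hu v hv w hw with (h | h) | ⟨k, hk, rfl⟩
    · omega
    · omega
    · exact hk
  have hne : ∀ a b : Cell (Fin m) (Fin n), cellCode a < cellCode b → a ≠ b := by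
    rintro a _ hab rfl
    exact lt_irrefl _ hab
  convert h.steinerPacks hn (S := [u, v, w])
    (by simp [hne u v huv, hne u w (huv.trans hvw), hne v w hvw]) hmem
  ext
  simp

/-- Packings in the `1 × 1` case. -/
def packingOneOne : List (List ℕ × List (List ℕ × List ℕ)) := [
  ([1, 10, 11],
    [([1, 11, 10], [11])])]

/-- Packings in the `1 × 2` case. -/
def packingOneTwo : List (List ℕ × List (List ℕ × List ℕ)) := [
  ([1, 2, 10],
    [([1, 10, 2], [10]), ([2, 12, 11, 10], [1, 11])]),
  ([1, 2, 11],
    [([2, 10, 11], [1, 10]), ([1, 11, 12, 2], [11])]),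
  ([1, 10, 11],
    [([1, 10, 12, 11], [10]), ([1, 11, 10], [11])]),
  ([1, 10, 12],
    [([1, 10, 12], [10]), ([10, 11, 12], [1, 11])]),
  ([1, 11, 12],
    [([11, 10, 12], [1, 10]), ([1, 11, 12], [11])]),
  ([10, 11, 12],
    [([10, 12, 11], [12]), ([11, 10, 2, 12], [10])])]

/-- Packings in the `1 × 3` case. -/
def packingOneThree : List (List ℕ × List (List ℕ × List ℕ)) := [
  ([1, 2, 3],
    [([2, 10, 3], [1, 10]), ([1, 11, 13, 12, 2], [3, 13])]),
  ([1, 2, 10],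
    [([1, 10, 2], [10]), ([2, 12, 11, 10], [1, 11])]),
  ([1, 2, 11],
    [([2, 10, 11], [1, 10]), ([1, 11, 12, 2], [11])]),
  ([1, 2, 13],
    [([2, 10, 13], [1, 10]), ([1, 11, 12, 13], [2, 12])]),
  ([1, 10, 11],
    [([1, 11, 10], [11]), ([1, 10, 12, 11], [10])]),
  ([1, 10, 12],
    [([10, 11, 12], [1, 11]), ([1, 10, 12], [10])]),
  ([1, 11, 12],
    [([1, 11, 12], [11]), ([11, 10, 12], [1, 10])]),
  ([1, 12, 13],
    [([12, 10, 13], [1, 10]), ([12, 11, 13], [1, 11])]),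
  ([10, 11, 12],
    [([10, 12, 11], [12]), ([11, 10, 2, 12], [10])]),
  ([11, 12, 13],
    [([12, 10, 13], [11, 10]), ([11, 13, 12], [13])])]

/-- Packings in the `2 × 2` case. -/
def packingTwoTwo : List (List ℕ × List (List ℕ × List ℕ)) := [
  ([1, 2, 10],
    [([1, 10, 2], [10]), ([2, 20, 21, 11, 10], [1, 20]), ([1, 11, 12, 10], [2, 12])]),
  ([1, 2, 11],
    [([2, 10, 11], [1, 10]), ([1, 11, 12, 2], [11]), ([2, 20, 21, 11], [1, 20])]),
  ([1, 10, 11],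
    [([1, 10, 11], [10]), ([10, 2, 20, 21, 11], [1, 20]), ([1, 11, 12, 10], [11])]),
  ([1, 10, 12],
    [([1, 10, 12], [10]), ([10, 11, 12], [1, 11]), ([1, 20, 2, 12], [10, 2])]),
  ([1, 10, 20],
    [([10, 11, 21, 20], [1, 11]), ([1, 21, 22, 2, 20], [10, 2]), ([10, 1, 20], [1])]),
  ([1, 10, 21],
    [([10, 1, 21], [1]), ([10, 11, 21], [1, 11]), ([10, 2, 20, 21], [1, 20])]),
  ([1, 10, 22],
    [([10, 11, 12, 22], [1, 11]), ([10, 1, 21, 22], [1]), ([10, 2, 20, 22], [1, 20])]),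
  ([1, 11, 12],
    [([11, 10, 12], [1, 10]), ([11, 21, 22, 12], [1, 21]), ([1, 11, 12], [11])]),
  ([1, 11, 21],
    [([1, 21, 11], [21]), ([11, 1, 20, 21], [1]), ([1, 10, 12, 22, 21], [11, 12])]),
  ([1, 11, 22],
    [([1, 11, 12, 22], [11]), ([11, 21, 22], [1, 21]), ([11, 10, 1, 20, 22], [1])]),
  ([1, 12, 22],
    [([1, 10, 2, 22], [12, 2]), ([12, 11, 21, 22], [1, 21]), ([1, 20, 22, 12], [22])]),
  ([10, 11, 12],
    [([11, 10, 12], [10]), ([10, 1, 11, 12], [11]), ([10, 2, 22, 21, 11], [12, 22])]),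
  ([10, 11, 20],
    [([10, 11, 21, 20], [11]), ([11, 1, 20], [10, 1]), ([11, 12, 2, 20], [10, 2])]),
  ([10, 11, 21],
    [([10, 11, 21], [11]), ([11, 1, 21], [10, 1]), ([11, 12, 22, 21], [10, 12])]),
  ([10, 11, 22],
    [([11, 12, 22], [10, 12]), ([10, 1, 21, 22], [11, 21]), ([11, 10, 2, 22], [10])]),
  ([10, 21, 22],
    [([10, 1, 21, 22], [21]), ([21, 11, 10, 12, 22], [10]), ([10, 2, 22, 20, 21], [22])]),
  ([11, 12, 21],
    [([11, 10, 2, 22, 21], [12, 22]), ([12, 10, 1, 21], [11, 1]), ([12, 11, 21], [11])])]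

/-- Packings in the `2 × 3` case. -/
def packingTwoThree : List (List ℕ × List (List ℕ × List ℕ)) := [
  ([1, 2, 3],
    [([2, 20, 3], [1, 20]), ([2, 10, 3], [1, 10]), ([1, 21, 23, 22, 2], [3, 23]),
     ([1, 11, 12, 13, 3], [2, 12])]),
  ([1, 2, 10],
    [([1, 10, 2], [10]), ([1, 11, 12, 10], [2, 12]), ([2, 20, 3, 10], [1, 20]),
     ([2, 22, 21, 11, 10], [1, 21])]),
  ([1, 2, 11],
    [([2, 10, 11], [1, 10]), ([1, 11, 12, 2], [11]), ([2, 22, 21, 11], [1, 21]),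
     ([2, 20, 3, 13, 11], [1, 20])]),
  ([1, 2, 13],
    [([2, 10, 13], [1, 10]), ([2, 20, 3, 13], [1, 20]), ([2, 12, 11, 13], [1, 11]),
     ([1, 21, 22, 12, 13], [2, 22])]),
  ([1, 10, 11],
    [([1, 10, 11], [10]), ([1, 11, 12, 10], [11]), ([1, 20, 3, 13, 11], [10, 3]),
     ([10, 13, 23, 21, 11], [1, 21])]),
  ([1, 10, 12],
    [([10, 11, 12], [1, 11]), ([1, 10, 12], [10]), ([1, 20, 2, 12], [10, 2]),
     ([1, 21, 23, 13, 12], [10, 13])]),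
  ([1, 10, 20],
    [([10, 13, 23, 21, 20], [1, 21]), ([1, 11, 12, 2, 20], [10, 2]), ([1, 20, 3, 10], [20]),
     ([1, 10, 11, 21, 22, 20], [10])]),
  ([1, 10, 21],
    [([1, 10, 11, 21], [10]), ([10, 3, 20, 21], [1, 20]), ([1, 21, 22, 12, 10], [21]),
     ([1, 11, 13, 23, 21], [10, 13])]),
  ([1, 10, 22],
    [([1, 11, 12, 22], [10, 12]), ([10, 11, 21, 22], [1, 21]), ([1, 10, 2, 22], [10]),
     ([10, 3, 20, 22], [1, 20])]),
  ([1, 11, 12],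
    [([11, 10, 12], [1, 10]), ([11, 21, 22, 12], [1, 21]), ([1, 11, 12], [11]),
     ([1, 20, 23, 13, 12], [11, 13])]),
  ([1, 11, 21],
    [([1, 10, 13, 23, 21], [11, 13]), ([1, 11, 21], [11]), ([11, 10, 3, 20, 21], [1, 20]),
     ([1, 21, 22, 12, 11], [21])]),
  ([1, 11, 22],
    [([11, 21, 22], [1, 21]), ([11, 10, 2, 22], [1, 10]), ([1, 20, 23, 13, 11], [22, 23]),
     ([1, 11, 12, 22], [11])]),
  ([1, 12, 13],
    [([12, 10, 13], [1, 10]), ([12, 11, 13], [1, 11]), ([1, 21, 22, 12, 13], [12]),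
     ([12, 2, 20, 3, 13], [1, 20])]),
  ([1, 12, 22],
    [([1, 10, 12, 22], [12]), ([12, 2, 20, 22], [1, 20]), ([12, 11, 21, 22], [1, 21]),
     ([1, 11, 13, 23, 22], [12, 13])]),
  ([1, 12, 23],
    [([1, 11, 13, 23], [12, 13]), ([12, 2, 20, 23], [1, 20]), ([1, 21, 22, 23], [12, 22]),
     ([12, 10, 3, 23], [1, 10])]),
  ([10, 11, 12],
    [([11, 10, 12], [10]), ([10, 1, 11, 12], [11]), ([11, 13, 12], [10, 13]),
     ([11, 21, 20, 2, 12], [10, 2])]),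
  ([10, 11, 20],
    [([11, 10, 3, 20], [10]), ([11, 1, 20], [10, 1]), ([11, 12, 22, 20], [10, 12]),
     ([10, 2, 20, 21, 11], [20])]),
  ([10, 11, 21],
    [([11, 1, 21], [10, 1]), ([11, 12, 22, 21], [10, 12]), ([10, 11, 21], [11]),
     ([11, 13, 23, 21], [10, 13])]),
  ([10, 11, 22],
    [([11, 12, 22], [10, 12]), ([10, 11, 21, 22], [11]), ([11, 13, 23, 22], [10, 13]),
     ([11, 1, 20, 22], [10, 1])]),
  ([10, 21, 22],
    [([21, 1, 20, 22], [10, 1]), ([10, 13, 23, 22], [21, 23]), ([10, 12, 22, 21], [22]),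
     ([21, 11, 10, 2, 22], [10])]),
  ([11, 12, 13],
    [([11, 12, 13], [12]), ([11, 13, 10, 12], [13]), ([12, 2, 10, 3, 13], [11, 10]),
     ([11, 21, 23, 22, 12], [13, 23])]),
  ([11, 12, 21],
    [([12, 10, 1, 21], [11, 1]), ([12, 13, 23, 21], [11, 13]), ([11, 10, 2, 20, 21], [12, 2]),
     ([12, 11, 21], [11])]),
  ([11, 12, 23],
    [([12, 13, 23], [11, 13]), ([11, 12, 22, 23], [12]), ([12, 10, 3, 23], [11, 10]),
     ([11, 1, 20, 2, 12], [23, 20])])]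

/-- Packings in the `3 × 3` case, for terminals in three different rows. -/
def packingThreeThree : List (List ℕ × List (List ℕ × List ℕ)) := [
  ([10, 20, 30],
    [([20, 2, 30], [10, 2]), ([20, 3, 30], [10, 3]), ([20, 1, 30], [10, 1]),
     ([10, 11, 31, 21, 20], [30, 31]), ([10, 13, 33, 23, 20], [30, 33])]),
  ([10, 20, 31],
    [([20, 3, 30, 31], [10, 3]), ([20, 21, 11, 31], [10, 11]), ([20, 1, 31], [10, 1]),
     ([20, 2, 32, 31], [10, 2]), ([10, 13, 33, 23, 20], [31, 33])]),
  ([10, 21, 31],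
    [([21, 1, 31], [10, 1]), ([21, 11, 31], [10, 11]), ([10, 3, 33, 31, 21], [31]),
     ([10, 12, 32, 22, 21], [31, 32]), ([21, 20, 2, 30, 31], [10, 2])]),
  ([10, 21, 32],
    [([21, 20, 2, 32], [10, 2]), ([10, 3, 23, 33, 32], [21, 23]), ([21, 1, 30, 32], [10, 1]),
     ([21, 11, 12, 32], [10, 12]), ([10, 11, 31, 32], [21, 31])]),
  ([11, 21, 31],
    [([21, 11, 31], [11]), ([11, 1, 31, 21], [31]), ([21, 22, 12, 32, 31], [11, 12]),
     ([11, 13, 23, 33, 31], [21, 23]), ([11, 10, 1, 30, 31], [21, 1])]),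
  ([11, 21, 32],
    [([21, 31, 32], [11, 31]), ([21, 22, 12, 32], [11, 12]), ([11, 21, 23, 33, 32], [21]),
     ([21, 1, 30, 32], [11, 1]), ([11, 10, 2, 20, 21], [32, 2])]),
  ([11, 22, 33],
    [([11, 12, 32, 33], [22, 32]), ([11, 21, 23, 33], [22, 23]), ([22, 21, 31, 33], [11, 31]),
     ([22, 12, 13, 33], [11, 13]), ([11, 10, 3, 20, 22], [33, 3])])]

/-- Packings in the `3 × 4` case, for terminals in three different rows. -/
def packingThreeFour : List (List ℕ × List (List ℕ × List ℕ)) := [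
  ([10, 20, 30],
    [([20, 4, 30], [10, 4]), ([20, 1, 30], [10, 1]), ([20, 2, 30], [10, 2]),
     ([20, 3, 30], [10, 3]), ([20, 23, 13, 33, 30], [10, 13]), ([10, 12, 32, 22, 20], [30, 32])]),
  ([10, 20, 31],
    [([20, 1, 31], [10, 1]), ([20, 21, 11, 31], [10, 11]), ([20, 4, 34, 31], [10, 4]),
     ([20, 2, 32, 31], [10, 2]), ([20, 3, 33, 31], [10, 3]), ([10, 14, 24, 21, 31], [20, 24])]),
  ([10, 21, 31],
    [([10, 14, 34, 31, 21], [31]), ([21, 11, 31], [10, 11]), ([21, 1, 31], [10, 1]),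
     ([21, 20, 2, 32, 31], [10, 2]), ([21, 24, 4, 30, 31], [10, 4]),
     ([21, 23, 13, 33, 31], [10, 13])]),
  ([10, 21, 32],
    [([10, 11, 31, 32], [21, 31]), ([21, 1, 30, 32], [10, 1]), ([21, 22, 2, 32], [10, 2]),
     ([21, 11, 12, 32], [10, 12]), ([10, 4, 24, 34, 32], [21, 24]), ([21, 20, 3, 33, 32], [10, 3])]),
  ([11, 21, 31],
    [([11, 21, 31], [21]), ([21, 1, 31], [11, 1]), ([11, 31, 34, 24, 21], [31]),
     ([21, 22, 12, 32, 31], [11, 12]), ([11, 13, 23, 33, 31], [21, 23]),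
     ([21, 20, 2, 30, 31], [11, 10, 2])]),
  ([11, 21, 32],
    [([21, 31, 32], [11, 31]), ([21, 11, 12, 32], [11]), ([21, 1, 30, 32], [11, 1]),
     ([11, 13, 23, 22, 32], [21, 23]), ([11, 10, 2, 20, 21], [32, 2]),
     ([11, 14, 34, 24, 21], [32, 34])]),
  ([11, 22, 33],
    [([11, 21, 23, 33], [22, 23]), ([22, 21, 31, 33], [11, 31]), ([11, 12, 32, 33], [22, 32]),
     ([22, 12, 13, 33], [11, 13]), ([11, 14, 24, 34, 33], [22, 24]),
     ([11, 1, 30, 2, 22], [33, 30])])]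

theorem isValid_packingOneOne : isValid 1 1 1 packingOneOne := by decide +kernel

theorem isValid_packingOneTwo : isValid 1 2 2 packingOneTwo := by decide +kernel

theorem isValid_packingOneThree : isValid 1 3 2 packingOneThree := by decide +kernel

theorem isValid_packingTwoTwo : isValid 2 2 3 packingTwoTwo := by decide +kernel

theorem isValid_packingTwoThree : isValid 2 3 4 packingTwoThree := by decide +kernel

theorem isValid_packingThreeThree : isValid 3 3 5 packingThreeThree := by decide +kernel

theorem isValid_packingThreeFour : isValid 3 4 6 packingThreeFour := by decide +kernel

theorem covers_packingOneOne :
    covers (imageMasks 1 1 packingOneOne) (cells 1 1) (cells 1 1) (cells 1 1) = true := by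
  decide +kernel

theorem covers_packingOneTwo :
    covers (imageMasks 1 2 packingOneTwo) (cells 1 2) (cells 1 2) (cells 1 2) = true := by
  decide +kernel

theorem covers_packingOneThree :
    covers (imageMasks 1 3 packingOneThree) (cells 1 3) (cells 1 3) (cells 1 3) = true := by
  decide +kernel

theorem covers_packingTwoTwo :
    covers (imageMasks 2 2 packingTwoTwo) (cells 2 2) (cells 2 2) (cells 2 2) = true := by
  decide +kernel

theorem covers_packingTwoThree :
    covers (imageMasks 2 3 packingTwoThree) (cells 2 3) (cells 2 3) (cells 2 3) = true := by
  decide +kernel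

theorem covers_packingThreeThree :
    covers (imageMasks 3 3 packingThreeThree) (rowCells 3 3 0) (rowCells 3 3 1) (rowCells 3 3 2) =
      true := by
  decide +kernel

theorem covers_packingThreeFour :
    covers (imageMasks 3 4 packingThreeFour) (rowCells 3 4 0) (rowCells 3 4 1) (rowCells 3 4 2) =
      true := by
  decide +kernel

end Certificates

end SimpleGraph

namespace SimpleGraph

/-! ### The lower bound: free rows and columns, base cases, induction. -/

section Lower

variable {R C R' C' : Type*}

/-- The row of a cell. -/
def cellRow : Cell R C → Option R
  | .inl (.inl i) => some i
  | .inl (.inr _) => none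
  | .inr (i, _) => some i

/-- The column of a cell. -/
def cellCol : Cell R C → Option C
  | .inl (.inl _) => none
  | .inl (.inr j) => some j
  | .inr (_, j) => some j

theorem mem_range_cellMap {f : R ↪ R'} {g : C ↪ C'} {v : Cell R' C'}
    (hr : ∀ i ∈ cellRow v, i ∈ Set.range f) (hc : ∀ j ∈ cellCol v, j ∈ Set.range g) :
    v ∈ Set.range (cellMap f g) := by
  obtain ((i | j) | ⟨i, j⟩) := v
  · obtain ⟨i, rfl⟩ := hr i rfl
    exact ⟨.inl (.inl i), rfl⟩
  · obtain ⟨j, rfl⟩ := hc j rfl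
    exact ⟨.inl (.inr j), rfl⟩
  · obtain ⟨i, rfl⟩ := hr i rfl
    obtain ⟨j, rfl⟩ := hc j rfl
    exact ⟨.inr (i, j), rfl⟩

theorem exists_image_eq {α β : Type*} {f : α ↪ β} {S : Finset β} (h : ∀ v ∈ S, v ∈ Set.range f) :
    ∃ S' : Finset α, S'.card = S.card ∧ f '' (S' : Set α) = S := by
  refine ⟨S.preimage f f.injective.injOn, ?_, ?_⟩
  · rw [← Finset.card_map f]
    congr 1
    ext v
    simp only [Finset.mem_map, Finset.mem_preimage]
    constructor
    · rintro ⟨a, ha, rfl⟩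
      exact ha
    · intro hv
      obtain ⟨a, rfl⟩ := h v hv
      exact ⟨a, hv, rfl⟩
  · rw [Finset.coe_preimage, Set.image_preimage_eq_iff]
    exact h

/-- Pigeonhole for `cellRow` and `cellCol`, which are partial because a head lies in only a row or
only a column. -/
theorem exists_notMem_of_card_lt {α β : Type*} [Fintype β] (S : Finset α) (f : α → Option β)
    (h : S.card < Fintype.card β) : ∃ b, ∀ v ∈ S, f v ≠ some b := by
  classical
  by_contra! hb
  choose g hg hgf using hb
  have : Function.Injective g := fun a b hab => by
    have := hgf a
    rw [hab, hgf b] at this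
    exact (Option.some.inj this).symm
  have h2 := Finset.card_le_card_of_injOn (s := Finset.univ) (t := S) g (fun a _ => hg a)
    this.injOn
  rw [Finset.card_univ] at h2
  omega

variable {m n t : ℕ}

/-- Every three vertices are connected by `t` edge-disjoint subgraphs. -/
def Packs3 (m n t : ℕ) : Prop :=
  ∀ S : Finset (Cell (Fin m) (Fin n)), S.card = 3 → (cellGraph (Fin m) (Fin n)).SteinerPacks S t

theorem mem_range_succAbove {r i : Fin (m + 1)} (h : i ≠ r) : i ∈ Set.range r.succAboveEmb := by
  simpa [Fin.range_succAbove] using h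

theorem steinerPacks_of_free {S : Finset (Cell (Fin (m + 1)) (Fin (n + 1)))} (h : Packs3 m n t)
    (hS : S.card = 3) {r : Fin (m + 1)} (hr : ∀ v ∈ S, cellRow v ≠ some r) {c : Fin (n + 1)}
    (hc : ∀ v ∈ S, cellCol v ≠ some c) :
    (cellGraph (Fin (m + 1)) (Fin (n + 1))).SteinerPacks S (t + 2) := by
  obtain ⟨S', hcard, hS'⟩ := exists_image_eq (f := cellMap r.succAboveEmb c.succAboveEmb) (S := S)
    fun v hv => mem_range_cellMap
      (fun i hi => mem_range_succAbove fun e => hr v hv (by rw [← e]; exact hi))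
      (fun j hj => mem_range_succAbove fun e => hc v hv (by rw [← e]; exact hj))
  rw [← hS']
  exact (h S' (hcard.trans hS)).add_row_col (r := r) (c := c) (by simp) (by simp)

theorem Packs3.succ (h : Packs3 m n t) (hm : 3 ≤ m) (hn : 3 ≤ n) :
    Packs3 (m + 1) (n + 1) (t + 2) := by
  intro S hS
  obtain ⟨r, hr⟩ := exists_notMem_of_card_lt S cellRow (by simp; omega)
  obtain ⟨c, hc⟩ := exists_notMem_of_card_lt S cellCol (by simp; omega)
  exact steinerPacks_of_free h hS hr hc

/-- With at least four columns one is free of terminals, and deleting it leaves a grid where the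
packing already exists. -/
theorem Packs3.succ_col (h : Packs3 m n t) (hn : 3 ≤ n) : Packs3 m (n + 1) t := by
  intro S hS
  obtain ⟨c, hc⟩ := exists_notMem_of_card_lt S cellCol (by simp; omega)
  obtain ⟨S', hcard, hS'⟩ := exists_image_eq
    (f := cellMap (Function.Embedding.refl (Fin m)) c.succAboveEmb) (S := S)
    fun v hv => mem_range_cellMap (fun i hi => ⟨i, rfl⟩)
      (fun j hj => mem_range_succAbove fun e => hc v hv (by rw [← e]; exact hj))
  rw [← hS']
  exact (h S' (hcard.trans hS)).map _ (cellGraph_map_le _ _)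

theorem packs3_of_covers [NeZero m] [NeZero n] (hn : n ≤ 9)
    {table : List (List ℕ × List (List ℕ × List ℕ))} (h : isValid m n t table)
    (hc : covers (imageMasks m n table) (cells m n) (cells m n) (cells m n) = true) :
    Packs3 m n t := by
  intro S hS
  obtain ⟨u, v, w, huv, huw, hvw, rfl⟩ := Finset.card_eq_three.mp hS
  have key : ∀ u v w : Cell (Fin m) (Fin n), cellCode u < cellCode v → cellCode v < cellCode w →
      (cellGraph (Fin m) (Fin n)).SteinerPacks {u, v, w} t := fun u v w =>
    h.steinerPacks_of_covers hn hc (mem_cells u) (mem_cells v) (mem_cells w)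
  have hlt : ∀ a b : Cell (Fin m) (Fin n), a ≠ b →
      cellCode a < cellCode b ∨ cellCode b < cellCode a := fun a b hab =>
    lt_or_gt_of_ne ((cellCode_injective hn).ne hab)
  push_cast
  -- The tables cover triples in increasing code order. Of the eight sign patterns, six are
  -- orderings and two are cyclic, hence impossible.
  rcases hlt u v huv with h1 | h1 <;> rcases hlt v w hvw with h2 | h2 <;>
    rcases hlt u w huw with h3 | h3
  · exact key u v w h1 h2
  · omega
  · rw [Set.pair_comm v w]
    exact key u w v h3 h2
  · rw [Set.pair_comm v w, Set.insert_comm u w]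
    exact key w u v h3 h1
  · rw [Set.insert_comm u v]
    exact key v u w h1 h3
  · rw [Set.insert_comm u v, Set.pair_comm u w]
    exact key v w u h2 h3
  · omega
  · rw [Set.insert_comm u v, Set.pair_comm u w, Set.insert_comm v w]
    exact key w v u h2 h1

theorem mem_rowCells {v : Cell (Fin m) (Fin n)} {i : Fin m} (h : cellRow v = some i) :
    v ∈ rowCells m n i := by
  obtain ((k | j) | ⟨k, j⟩) := v <;> simp_all [cellRow, rowCells]

theorem cellCode_lt_cellCode {u v : Cell (Fin m) (Fin n)} {i k : Fin m} (hn : n ≤ 9)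
    (hu : cellRow u = some i) (hv : cellRow v = some k) (hik : i < k) :
    cellCode u < cellCode v := by
  obtain ((i' | j) | ⟨i', j⟩) := u <;> obtain ((k' | l) | ⟨k', l⟩) := v <;>
    simp_all [cellRow, cellCode] <;> omega

/-- Three terminals that meet all three rows lie one in each, and their codes then increase with the
row. -/
theorem steinerPacks_of_rows [NeZero n] (hn : n ≤ 9)
    {table : List (List ℕ × List (List ℕ × List ℕ))} (h : isValid 3 n t table)
    (hc : covers (imageMasks 3 n table) (rowCells 3 n 0) (rowCells 3 n 1) (rowCells 3 n 2) = true)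
    {S : Finset (Cell (Fin 3) (Fin n))} (hS : S.card = 3)
    (hrow : ∀ r : Fin 3, ∃ v ∈ S, cellRow v = some r) :
    (cellGraph (Fin 3) (Fin n)).SteinerPacks S t := by
  choose f hf hfr using hrow
  have hne : ∀ a b : Fin 3, a ≠ b → f a ≠ f b := fun a b hab e => by
    have := hfr a
    rw [e, hfr b] at this
    exact hab (Option.some.inj this).symm
  have hSeq : ({f 0, f 1, f 2} : Finset _) = S := by
    refine Finset.eq_of_subset_of_card_le ?_ ?_
    · simp [Finset.insert_subset_iff, hf]
    · rw [hS, Finset.card_eq_three.mpr ⟨_, _, _, hne 0 1 (by decide), hne 0 2 (by decide),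
        hne 1 2 (by decide), rfl⟩]
  rw [← hSeq]
  simpa using h.steinerPacks_of_covers hn hc (mem_rowCells (hfr 0)) (mem_rowCells (hfr 1))
    (mem_rowCells (hfr 2)) (cellCode_lt_cellCode hn (hfr 0) (hfr 1) (by decide))
    (cellCode_lt_cellCode hn (hfr 1) (hfr 2) (by decide))

theorem packs3_one_one : Packs3 1 1 1 :=
  packs3_of_covers (by norm_num) isValid_packingOneOne covers_packingOneOne

theorem packs3_one_two : Packs3 1 2 2 :=
  packs3_of_covers (by norm_num) isValid_packingOneTwo covers_packingOneTwo

theorem packs3_one_three : Packs3 1 3 2 :=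
  packs3_of_covers (by norm_num) isValid_packingOneThree covers_packingOneThree

theorem packs3_two_two : Packs3 2 2 3 :=
  packs3_of_covers (by norm_num) isValid_packingTwoTwo covers_packingTwoTwo

theorem packs3_two_three : Packs3 2 3 4 :=
  packs3_of_covers (by norm_num) isValid_packingTwoThree covers_packingTwoThree

/-- If a row and a column are free, the `2 × 2` case is augmented. Otherwise all rows or all columns
are met, and transposition turns the second case into the first. -/
theorem packs3_three_three : Packs3 3 3 5 := by
  intro S hS
  by_cases hr : ∃ r, ∀ v ∈ S, cellRow v ≠ some r
  · by_cases hc : ∃ c, ∀ v ∈ S, cellCol v ≠ some c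
    · obtain ⟨r, hr⟩ := hr
      obtain ⟨c, hc⟩ := hc
      exact steinerPacks_of_free packs3_two_two hS hr hc
    · push Not at hc
      obtain ⟨S', hcard, hS'⟩ := exists_image_eq (f := cellSwap) (S := S) fun v _ =>
        ((Equiv.sumComm (Fin 3) (Fin 3)).sumCongr (Equiv.prodComm _ _)).surjective v
      rw [← hS']
      refine SteinerPacks.map ?_ cellSwap cellGraph_map_cellSwap_le
      refine steinerPacks_of_rows (by norm_num) isValid_packingThreeThree covers_packingThreeThree
        (hcard.trans hS) fun r => ?_
      obtain ⟨v, hv, hvr⟩ := hc r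
      rw [← Finset.mem_coe, ← hS'] at hv
      obtain ⟨u, hu, rfl⟩ := hv
      refine ⟨u, hu, ?_⟩
      obtain ((i | j) | ⟨i, j⟩) := u
      · exact hvr
      · exact hvr
      · exact hvr
  · push Not at hr
    exact steinerPacks_of_rows (by norm_num) isValid_packingThreeThree covers_packingThreeThree
      hS hr

/-- Four columns always leave one free, so only the rows need a case distinction. -/
theorem packs3_three_four : Packs3 3 4 6 := by
  intro S hS
  by_cases hr : ∃ r, ∀ v ∈ S, cellRow v ≠ some r
  · obtain ⟨r, hr⟩ := hr
    obtain ⟨c, hc⟩ := exists_notMem_of_card_lt S cellCol (by simp; omega)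
    exact steinerPacks_of_free packs3_two_three hS hr hc
  · push Not at hr
    exact steinerPacks_of_rows (by norm_num) isValid_packingThreeFour covers_packingThreeFour hS hr

theorem packs3_self : ∀ m, 1 ≤ m → Packs3 m m (2 * m - 1)
  | 0, h => by omega
  | 1, _ => packs3_one_one
  | 2, _ => packs3_two_two
  | 3, _ => packs3_three_three
  | m + 4, _ => (packs3_self (m + 3) (by omega)).succ (by omega) (by omega)

theorem packs3_succ_self : ∀ m, 1 ≤ m → Packs3 m (m + 1) (2 * m)
  | 0, h => by omega
  | 1, _ => packs3_one_two
  | 2, _ => packs3_two_three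
  | 3, _ => packs3_three_four
  | m + 4, _ => (packs3_succ_self (m + 3) (by omega)).succ (by omega) (by omega)

theorem packs3_of_lt (hm : 1 ≤ m) (hmn : m < n) : Packs3 m n (2 * m) := by
  induction n, hmn using Nat.le_induction with
  | base => exact packs3_succ_self m hm
  | succ n hmn ih =>
    by_cases hn : 3 ≤ n
    · exact ih.succ_col hn
    -- In the `1 × 3` grid the terminals may occupy all three columns, so a table replaces the
    -- deletion of a column.
    · obtain ⟨rfl, rfl⟩ : m = 1 ∧ n = 2 := by omega
      exact packs3_one_three

theorem Packs3.le_genEdgeConn (h : Packs3 m n t) :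
    (t : ℕ∞) ≤ (completeBipartiteGraph (Fin m) (Fin n)).totalGraph.genEdgeConn 3 := by
  refine le_iInf fun S => le_iInf fun hS => ?_
  obtain ⟨S', hcard, hS'⟩ := exists_image_eq (f := totalCell) (S := S)
    fun v _ => totalCell_surjective v
  have h1 := (h S' (hcard.trans hS)).map totalCell map_totalCell_le
  rw [hS'] at h1
  exact h1.le_localEdgeConn (by omega)

end Lower

end SimpleGraph

namespace SimpleGraph

/-! ### The upper bound: counting edges at the ends of a flag. -/

section Upper

variable {R C : Type*}

open Classical in
/-- The edges of the total graph at the vertex `i` of the first part. -/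
noncomputable def rowHeadEdges [Fintype C] (i : R) :
    Finset (Sym2 ((R ⊕ C) ⊕ (completeBipartiteGraph R C).edgeSet)) :=
  Finset.univ.image fun p : C ⊕ C =>
    s(.inl (.inl i), p.elim (fun j => .inl (.inr j)) fun j => .inr (bipartiteEdge i j))

open Classical in
/-- The edges of the total graph at the vertex `j` of the second part. -/
noncomputable def colHeadEdges [Fintype R] (j : C) :
    Finset (Sym2 ((R ⊕ C) ⊕ (completeBipartiteGraph R C).edgeSet)) :=
  Finset.univ.image fun p : R ⊕ R =>
    s(.inl (.inr j), p.elim (fun i => .inl (.inl i)) fun i => .inr (bipartiteEdge i j))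

theorem card_rowHeadEdges_le [Fintype C] (i : R) :
    (rowHeadEdges (C := C) i).card ≤ 2 * Fintype.card C := by
  classical
  refine Finset.card_image_le.trans ?_
  simp [two_mul]

theorem card_colHeadEdges_le [Fintype R] (j : C) :
    (colHeadEdges (R := R) j).card ≤ 2 * Fintype.card R := by
  classical
  refine Finset.card_image_le.trans ?_
  simp [two_mul]

theorem mem_rowHeadEdges [Fintype C] {i : R} {w : (R ⊕ C) ⊕ (completeBipartiteGraph R C).edgeSet}
    (h : (completeBipartiteGraph R C).totalGraph.Adj (.inl (.inl i)) w) :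
    s(.inl (.inl i), w) ∈ rowHeadEdges (C := C) i := by
  simp only [rowHeadEdges, Finset.mem_image, Finset.mem_univ, true_and]
  obtain ((k | j) | e) := w
  · simp [totalGraph] at h
  · exact ⟨.inl j, rfl⟩
  · obtain ⟨k, j, rfl⟩ := exists_eq_bipartiteEdge e
    obtain rfl : i = k := by simpa [totalGraph, mem_bipartiteEdge] using h
    exact ⟨.inr j, rfl⟩

theorem mem_colHeadEdges [Fintype R] {j : C} {w : (R ⊕ C) ⊕ (completeBipartiteGraph R C).edgeSet}
    (h : (completeBipartiteGraph R C).totalGraph.Adj (.inl (.inr j)) w) :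
    s(.inl (.inr j), w) ∈ colHeadEdges (R := R) j := by
  simp only [colHeadEdges, Finset.mem_image, Finset.mem_univ, true_and]
  obtain ((i | k) | e) := w
  · exact ⟨.inl i, rfl⟩
  · simp [totalGraph] at h
  · obtain ⟨i, k, rfl⟩ := exists_eq_bipartiteEdge e
    obtain rfl : j = k := by simpa [totalGraph, mem_bipartiteEdge] using h
    exact ⟨.inr i, rfl⟩

open Classical in
/-- The ends of an edge of a complete bipartite graph together with that edge. -/
noncomputable def flag (i : R) (j : C) :
    Finset ((R ⊕ C) ⊕ (completeBipartiteGraph R C).edgeSet) :=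
  {.inl (.inl i), .inl (.inr j), .inr (bipartiteEdge i j)}

theorem card_flag (i : R) (j : C) : (flag i j).card = 3 := by
  classical
  exact Finset.card_eq_three.mpr ⟨_, _, _, by simp, by simp, by simp, rfl⟩

theorem localEdgeConn_flag_le [Fintype R] (i : R) (j : C) :
    (completeBipartiteGraph R C).totalGraph.localEdgeConn (flag i j) ≤
      (2 * Fintype.card R : ℕ) := by
  refine mul_localEdgeConn_le (k := 1) (colHeadEdges j) (fun T hT => ?_)
    (by have := card_colHeadEdges_le (R := R) j; omega)
  obtain ⟨a, rfl, b, -, hab⟩ := hT.exists_adj (A := {.inl (.inr j)}) (u := .inl (.inr j))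
    (v := .inl (.inl i)) (by simp [flag]) rfl (by simp [flag]) (by simp)
  exact ⟨{s(.inl (.inr j), b)}, by simpa using mem_colHeadEdges hab.adj_sub, by simp, by simpa⟩

theorem localEdgeConn_flag_le_sub_one [Fintype R] [Fintype C] (i : R) (j : C)
    (h : Fintype.card R = Fintype.card C) :
    (completeBipartiteGraph R C).totalGraph.localEdgeConn (flag i j) ≤
      (2 * Fintype.card R - 1 : ℕ) := by
  classical
  have hpos : 0 < Fintype.card R := Fintype.card_pos_iff.mpr ⟨i⟩
  have hcard : (rowHeadEdges i ∪ colHeadEdges j).card < 4 * Fintype.card R := by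
    have h1 := card_rowHeadEdges_le (C := C) i
    have h2 := card_colHeadEdges_le (R := R) j
    have h3 := Finset.card_union_add_card_inter (rowHeadEdges i) (colHeadEdges j)
    have h4 : 0 < (rowHeadEdges i ∩ colHeadEdges j).card := by
      -- The edge between `i` and `j` is counted at both ends, which makes the bound `4m` strict.
      refine Finset.card_pos.mpr ⟨s(.inl (.inl i), .inl (.inr j)), Finset.mem_inter.mpr ⟨?_, ?_⟩⟩
      · exact mem_rowHeadEdges (by simp [totalGraph])
      · rw [Sym2.eq_swap]
        exact mem_colHeadEdges (by simp [totalGraph])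
    omega
  refine mul_localEdgeConn_le (k := 2) _ (fun T hT => ?_) (hcard.trans_le (by omega))
  have hi : (.inl (.inl i)) ∈ flag i j := by simp [flag]
  have hj : (.inl (.inr j)) ∈ flag i j := by simp [flag]
  -- The tree leaves `{i, j}` by an edge from `i` or `j` to some `b` outside. Paired with any tree
  -- edge at the other of the two, it gives two distinct edges because `b` is neither `i` nor `j`.
  obtain ⟨a, ha, b, hb, hab⟩ := hT.exists_adj (A := {.inl (.inl i), .inl (.inr j)})
    (v := .inr (bipartiteEdge i j)) hi (by simp) (by simp [flag]) (by simp)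
  simp only [Set.mem_insert_iff, Set.mem_singleton_iff, not_or] at ha hb
  obtain ⟨p, rfl, q, -, hpq⟩ := hT.exists_adj (A := {.inl (.inl i)}) hi rfl hj (by simp)
  obtain ⟨p', rfl, q', -, hpq'⟩ := hT.exists_adj (A := {.inl (.inr j)}) hj rfl hi (by simp)
  have hq := mem_rowHeadEdges hpq.adj_sub
  have hq' := mem_colHeadEdges hpq'.adj_sub
  rcases ha with rfl | rfl
  · refine ⟨{s(.inl (.inl i), b), s(.inl (.inr j), q')}, ?_, Finset.card_pair ?_, ?_⟩
    · simp [Finset.insert_subset_iff, mem_rowHeadEdges hab.adj_sub, hq']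
    · simp [hb]
    · simp [Set.insert_subset_iff, hab, hpq']
  · refine ⟨{s(.inl (.inr j), b), s(.inl (.inl i), q)}, ?_, Finset.card_pair ?_, ?_⟩
    · simp [Finset.insert_subset_iff, mem_colHeadEdges hab.adj_sub, hq]
    · simp [hb]
    · simp [Set.insert_subset_iff, hab, hpq]

end Upper

end SimpleGraph

theorem theorem3p12 (m n : ℕ) (hm : 1 ≤ m) (hmn : m ≤ n) :
    (completeBipartiteGraph (Fin m) (Fin n)).totalGraph.genEdgeConn 3 =
      ((if m = n then 2 * m - 1 else 2 * m : ℕ) : ℕ∞) := by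
  let i : Fin m := ⟨0, hm⟩
  let j : Fin n := ⟨0, hm.trans hmn⟩
  have hle : (completeBipartiteGraph (Fin m) (Fin n)).totalGraph.genEdgeConn 3 ≤
      (completeBipartiteGraph (Fin m) (Fin n)).totalGraph.localEdgeConn
        (SimpleGraph.flag i j) :=
    iInf₂_le (SimpleGraph.flag i j) (SimpleGraph.card_flag i j)
  split_ifs with h
  · subst h
    refine le_antisymm (hle.trans ?_) (SimpleGraph.packs3_self m hm).le_genEdgeConn
    simpa using SimpleGraph.localEdgeConn_flag_le_sub_one i j rfl
  · refine le_antisymm (hle.trans ?_)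
      (SimpleGraph.packs3_of_lt hm (lt_of_le_of_ne hmn h)).le_genEdgeConn
    simpa using SimpleGraph.localEdgeConn_flag_le i j
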